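/- Let $d\ge 1$ be an integer and let $\langle\nabla\rangle=\sqrt{1-\Delta}$ be the self-adjoint operator on $L^2(\mathbb R^d)$ with domain $H^1(\mathbb R^d)$, that is, the Fourier multiplier with symbol $\langle\xi\rangle=\sqrt{1+|\xi|^2}$. For $X\subset\mathbb R^d$ convex, $\mathbf 1_X$ denotes multiplication by the characteristic function of $X$; for non-empty $X,Y$ put $\mathrm{dist}(X,Y)=\inf\{|x-y| : x\in X,\ y\in Y\}$; $\|\cdot\|$ is the operator norm on $L^2(\mathbb R^d)$. (1) For every real $\delta<1$ there exist $t>0$ and non-empty convex sets $X,Y\subset\mathbb R^d$ such that $$\big\|\mathbf 1_Y e^{-it\langle\nabla\rangle}\mathbf 1_X\big\|>e^{\delta t-\mathrm{dist}(X,Y)} .$$ (2) Hence the speed $1$ in the maximal velocity bound $\|\mathbf 1_Y U(t,0)\mathbf 1_X\|\le e^{t-\mathrm{dist}(X,Y)}$ ($X,Y$ convex, $0\le t\le T$, $U$ a unitary propagator generated by $(\langle\nabla\rangle+V_t)_{t\in[0,T]}$ with real potentials $V_t$) cannot be replaced by any smaller speed, even for $V_t=0$: for every real $c<1$ there exist $T>0$,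 a unitary propagator $(U(t,s))_{t,s\in[0,T]}$ generated by $\langle\nabla\rangle$ and non-empty convex sets $X,Y\subset\mathbb R^d$ such that the estimate $$\forall t\in[0,T],\qquad \|\mathbf 1_Y U(t,0)\mathbf 1_X\|\le e^{ct-\mathrm{dist}(X,Y)}$$ does not hold. Here a unitary propagator generated by a family $(A_t)_{t\in[0,T]}$ of self-adjoint operators on $L^2(\mathbb R^d)$, such that $\mathcal D(A_t)\cap H^{1/2}$ is dense in $H^{1/2}$ and $A_t$ extends continuously to an element of $\mathcal B(H^{1/2},H^{-1/2})$, is a family of unitary operators $U(t,s)$ on $L^2(\mathbb R^d)$, $t,s\in[0,T]$, with $U(t,t)=\mathbf 1$ and $U(t,s)U(s,r)=U(t,r)$ for all $t,s,r\in[0,T]$, such that for every $s\in[0,T]$ the map $t\mapsto U(t,s)$ is strongly continuous from $[0,T]$ to $\mathcal B(H^{1/2})$ and strongly $C^1$ from $[0,T]$ to $\mathcal B(H^{1/2},H^{-1/2})$, and $i\partial_tU(t,s)\psi=A_tU(t,s)\psi$ in $H^{-1/2}$ for all $\psi\in H^{1/2}$ and $t\in[0,T]$. -/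

import Mathlib

open MeasureTheory FourierTransform
open scoped ENNReal

noncomputable section

namespace PseudoRelativistic

/-- The Hilbert space `L²(ℝᵈ; ℂ)` with respect to Lebesgue measure. -/
abbrev L2 (d : ℕ) : Type := Lp ℂ 2 (volume : Measure (EuclideanSpace ℝ (Fin d)))

/-- `dist(X, Y) = inf {|x - y| : x ∈ X, y ∈ Y}`. -/
def setDist {d : ℕ} (X Y : Set (EuclideanSpace ℝ (Fin d))) : ℝ :=
  sInf {r : ℝ | ∃ x ∈ X, ∃ y ∈ Y, r = ‖x - y‖}

/-- The bounded operator of multiplication by an essentially bounded function on `L²(ℝᵈ)`. -/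
def mulOp {d : ℕ} (m : EuclideanSpace ℝ (Fin d) → ℂ) (hm : MemLp m ∞ volume) :
    L2 d →L[ℂ] L2 d :=
  (ContinuousLinearMap.mul ℂ ℂ).holderL volume ∞ 2 2 (hm.toLp m)

theorem mulOp_apply {d : ℕ} (m : EuclideanSpace ℝ (Fin d) → ℂ) (hm : MemLp m ∞ volume)
    (ψ : L2 d) : mulOp m hm ψ =ᵐ[volume] fun x => m x * ψ x := by
  have h := (ContinuousLinearMap.mul ℂ ℂ).coeFn_holder (r := 2) (hm.toLp m) ψ
  filter_upwards [h, hm.coeFn_toLp] with x hx hx'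
  rw [← hx']
  exact hx

theorem memLp_indicator_convex {d : ℕ} {X : Set (EuclideanSpace ℝ (Fin d))}
    (hX : Convex ℝ X) : MemLp (X.indicator (fun _ => (1 : ℂ))) ∞ volume := by
  refine memLp_top_of_bound
    (aestronglyMeasurable_const.indicator₀ (hX.nullMeasurableSet volume)) 1
    (Filter.Eventually.of_forall fun x => ?_)
  by_cases h : x ∈ X <;> simp [h]

/-- The operator `𝟏_X` on `L²(ℝᵈ)` for a convex set `X` (convex sets are Lebesgue measurable). -/
def indicatorOp {d : ℕ} (X : Set (EuclideanSpace ℝ (Fin d))) (hX : Convex ℝ X) :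
    L2 d →L[ℂ] L2 d :=
  mulOp (X.indicator fun _ => (1 : ℂ)) (memLp_indicator_convex hX)

/-- The symbol of `⟨∇⟩ = √(1 - Δ)`. Mathlib's Fourier transform has the kernel
`exp (-2πi x·ξ)`, so `-Δ` has the symbol `(2π|ξ|)²`. -/
def symbol {d : ℕ} (ξ : EuclideanSpace ℝ (Fin d)) : ℝ :=
  √(1 + (2 * Real.pi * ‖ξ‖) ^ 2)

theorem continuous_symbol {d : ℕ} : Continuous (symbol (d := d)) := by
  unfold symbol
  fun_prop

theorem one_le_symbol {d : ℕ} (ξ : EuclideanSpace ℝ (Fin d)) : 1 ≤ symbol ξ := by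
  unfold symbol
  rw [Real.one_le_sqrt]
  nlinarith [sq_nonneg (2 * Real.pi * ‖ξ‖)]

theorem memLp_exp_symbol (d : ℕ) (t : ℝ) :
    MemLp (fun ξ : EuclideanSpace ℝ (Fin d) => Complex.exp (-Complex.I * t * symbol ξ)) ∞
      volume := by
  have hc : Continuous (fun ξ : EuclideanSpace ℝ (Fin d) =>
      Complex.exp (-Complex.I * t * symbol ξ)) := by
    have := continuous_symbol (d := d)
    fun_prop
  refine memLp_top_of_bound hc.aestronglyMeasurable 1 (Filter.Eventually.of_forall fun ξ => ?_)
  rw [Complex.norm_exp]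
  simp

/-- The free evolution `exp(-it⟨∇⟩)`: the Fourier multiplier with symbol `exp(-it⟨ξ⟩)`. -/
def freeEvolution (d : ℕ) (t : ℝ) : L2 d →L[ℂ] L2 d :=
  fourierInvCLM ℂ (L2 d) ∘L mulOp _ (memLp_exp_symbol d t) ∘L fourierCLM ℂ (L2 d)

/-- The functions `f ∈ L²` with `⟨ξ⟩ f ∈ L²`. -/
def symbolDomain (d : ℕ) : Submodule ℂ (L2 d) where
  carrier := {f | MemLp (fun ξ => (symbol ξ : ℂ) * f ξ) 2 volume}
  zero_mem' := by
    refine (memLp_congr_ae ?_).2 (MemLp.zero (ε := ℂ))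
    filter_upwards [Lp.coeFn_zero ℂ 2 (volume : Measure (EuclideanSpace ℝ (Fin d)))] with ξ h
    rw [h]
    simp
  add_mem' := by
    intro f g hf hg
    refine (memLp_congr_ae ?_).2 (MemLp.add hf hg)
    filter_upwards [Lp.coeFn_add f g] with ξ h
    rw [h, Pi.add_apply, Pi.add_apply, mul_add]
  smul_mem' := by
    intro c f hf
    refine (memLp_congr_ae ?_).2 (MemLp.const_smul hf c)
    filter_upwards [Lp.coeFn_smul c f] with ξ h
    rw [h, Pi.smul_apply, Pi.smul_apply, smul_eq_mul, smul_eq_mul, mul_left_comm]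

theorem mem_symbolDomain {d : ℕ} (f : symbolDomain d) :
    MemLp (fun ξ => (symbol ξ : ℂ) * (f : L2 d) ξ) 2 volume :=
  f.2

/-- Multiplication by `⟨ξ⟩`, as a linear map from its natural domain to `L²`. -/
def symbolMul (d : ℕ) : symbolDomain d →ₗ[ℂ] L2 d where
  toFun f := (mem_symbolDomain f).toLp
  map_add' f g := by
    apply Lp.ext
    filter_upwards [Lp.coeFn_add (f : L2 d) g, (mem_symbolDomain (f + g)).coeFn_toLp,
      (mem_symbolDomain f).coeFn_toLp, (mem_symbolDomain g).coeFn_toLp,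
      Lp.coeFn_add (mem_symbolDomain f).toLp (mem_symbolDomain g).toLp] with ξ h h1 h2 h3 h4
    rw [h4, h1, Pi.add_apply, h2, h3, Submodule.coe_add, h, Pi.add_apply, mul_add]
  map_smul' c f := by
    apply Lp.ext
    filter_upwards [Lp.coeFn_smul c (f : L2 d), (mem_symbolDomain (c • f)).coeFn_toLp,
      (mem_symbolDomain f).coeFn_toLp,
      Lp.coeFn_smul c (mem_symbolDomain f).toLp] with ξ h h1 h2 h4
    rw [RingHom.id_apply, h4, h1, Pi.smul_apply, h2, Submodule.coe_smul, h, Pi.smul_apply,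
      smul_eq_mul, smul_eq_mul, mul_left_comm]

/-- The self-adjoint operator `⟨∇⟩ = √(1 - Δ)` on `L²(ℝᵈ)`: its domain is
`H¹ = {ψ ∈ L² : ⟨ξ⟩ 𝓕ψ ∈ L²}` and it acts as the Fourier multiplier with symbol `⟨ξ⟩`. -/
def japaneseOp (d : ℕ) : L2 d →ₗ.[ℂ] L2 d where
  domain := (symbolDomain d).comap (fourierCLM ℂ (L2 d)).toLinearMap
  toFun := (fourierInvCLM ℂ (L2 d)).toLinearMap ∘ₗ symbolMul d ∘ₗ
    ((fourierCLM ℂ (L2 d)).toLinearMap.restrict (q := symbolDomain d) fun _ h => h)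

/-- The measure `⟨ξ⟩^(2s) dξ`. -/
def sobolevMeasure (d : ℕ) (s : ℝ) : Measure (EuclideanSpace ℝ (Fin d)) :=
  volume.withDensity fun ξ => ENNReal.ofReal (symbol ξ ^ (2 * s))

/-- The Sobolev space `Hˢ(ℝᵈ)`, each tempered distribution `ψ ∈ Hˢ` being given by its Fourier
transform, a function with `⟨ξ⟩ˢ 𝓕ψ(ξ)` in `L²`; the norm is `‖⟨ξ⟩ˢ 𝓕ψ‖_{L²}`. -/
abbrev Sobolev (d : ℕ) (s : ℝ) : Type := Lp ℂ 2 (sobolevMeasure d s)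

/-- `ψ ∈ L²` and `g ∈ Hˢ` are the same tempered distribution. -/
def SameDistribution {d : ℕ} {s : ℝ} (ψ : L2 d) (g : Sobolev d s) : Prop :=
  (𝓕 ψ : L2 d) =ᵐ[volume] g

theorem sobolevMeasure_mono (d : ℕ) {s r : ℝ} (h : s ≤ r) :
    sobolevMeasure d s ≤ sobolevMeasure d r := by
  refine withDensity_mono (Filter.Eventually.of_forall fun ξ => ENNReal.ofReal_le_ofReal ?_)
  exact Real.rpow_le_rpow_of_exponent_le (one_le_symbol ξ) (by linarith)

/-- The inclusion of `H^{1/2}` into `H^{-1/2}`. -/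
def sobolevIncl (d : ℕ) (g : Sobolev d (1 / 2)) : Sobolev d (-(1 / 2)) :=
  MemLp.toLp g ((Lp.memLp g).mono_measure (sobolevMeasure_mono d (by norm_num)))

/-- The standing assumptions on a generator: `A` is a self-adjoint operator on `L²`, the set
`D(A) ∩ H^{1/2}` is dense in `H^{1/2}`, and `B` is the continuous extension of `A` (restricted to
this set) to an element of `𝓑(H^{1/2}, H^{-1/2})`. -/
structure IsGenerator {d : ℕ} (A : L2 d →ₗ.[ℂ] L2 d)
    (B : Sobolev d (1 / 2) →L[ℂ] Sobolev d (-(1 / 2))) : Prop where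
  selfAdjoint : IsSelfAdjoint A
  dense : Dense {g : Sobolev d (1 / 2) | ∃ ψ : A.domain, SameDistribution (ψ : L2 d) g}
  extends_op : ∀ (ψ : A.domain) (g : Sobolev d (1 / 2)),
    SameDistribution (ψ : L2 d) g → SameDistribution (A ψ) (B g)

/-- `(U(t,s))`, `t, s ∈ [0,T]`, is a unitary propagator associated with `i ∂ₜ ψₜ = Aₜ ψₜ`,
`t ∈ [0,T]`. In `evolution`, `u t` is the restriction of `U(t,s)` to `H^{1/2}`; the map
`t ↦ u t` is strongly continuous in `𝓑(H^{1/2})` and strongly `C¹` in `𝓑(H^{1/2}, H^{-1/2})`,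
and `i ∂ₜ U(t,s)ψ = Aₜ U(t,s)ψ` holds in `H^{-1/2}` for every `ψ ∈ H^{1/2}`. The values for
times outside `[0,T]` play no role. -/
structure IsUnitaryPropagator {d : ℕ} (T : ℝ) (A : ℝ → (L2 d →ₗ.[ℂ] L2 d))
    (U : ℝ → ℝ → (L2 d →L[ℂ] L2 d)) : Prop where
  isUnitary : ∀ t ∈ Set.Icc 0 T, ∀ s ∈ Set.Icc 0 T, U t s ∈ unitary (L2 d →L[ℂ] L2 d)
  refl : ∀ t ∈ Set.Icc 0 T, U t t = ContinuousLinearMap.id ℂ (L2 d)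
  comp : ∀ t ∈ Set.Icc 0 T, ∀ s ∈ Set.Icc 0 T, ∀ r ∈ Set.Icc 0 T, U t s ∘L U s r = U t r
  evolution : ∃ B : ℝ → (Sobolev d (1 / 2) →L[ℂ] Sobolev d (-(1 / 2))),
    (∀ t ∈ Set.Icc 0 T, IsGenerator (A t) (B t)) ∧
    ∀ s ∈ Set.Icc 0 T, ∃ u : ℝ → (Sobolev d (1 / 2) →L[ℂ] Sobolev d (1 / 2)),
      (∀ t ∈ Set.Icc 0 T, ∀ (ψ : L2 d) (g : Sobolev d (1 / 2)),
        SameDistribution ψ g → SameDistribution (U t s ψ) (u t g)) ∧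
      (∀ g, ContinuousOn (fun t => u t g) (Set.Icc 0 T)) ∧
      (∀ g, ∀ t ∈ Set.Icc 0 T,
        HasDerivWithinAt (fun τ => sobolevIncl d (u τ g)) (-Complex.I • B t (u t g))
          (Set.Icc 0 T) t) ∧
      (∀ g, ContinuousOn (fun t => -Complex.I • B t (u t g)) (Set.Icc 0 T))

end PseudoRelativistic

end

noncomputable section

namespace PseudoRelativistic

open Filter Topology

/-! ### Dominated convergence in `L²` -/

/-! The group velocity of `⟨∇⟩` tends to one at high momentum. For a unit vector `e` and fixed `ξ`,
the symbol at `ξ + l e` differs from the linear function `2π⟨e, ξ + l e⟩` by a quantity that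
vanishes as `l → ∞`, and the multiplier `exp(-2πit⟨e, ξ⟩)` is translation by `t e`. Hence a bump
modulated to momentum `l e` evolves, up to an `L²` error tending to zero, into its own translate by
`t e` (`tendsto_freeEvolution_wavePacket`).

A bump supported in the slab `-1 < x i < 0` starts in `{x i ≤ 0}` and is carried into `{t - 1 ≤ x
i}`. So the localized evolution has norm at least one for every `t`, although the half-spaces are at
distance at least `t - 1` when the direction is a coordinate axis (`one_le_norm_halfSpaces`). A
bound with speed `δ < 1` would give at most `exp(1 - (1 - δ)t)`, which is below one for large `t`.

The second claim also needs `exp(-i(t - s)⟨∇⟩)` to be a unitary propagator generated by `⟨∇⟩`. On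
the Fourier side the Sobolev spaces are weighted `L²` spaces and all operators are multiplications,
so continuity, differentiability and density follow from dominated convergence. Self-adjointness
comes from symmetry together with division by the symbol. -/

theorem tendsto_eLpNorm_two_of_dominated {α ι : Type*} [MeasurableSpace α] {μ : Measure α}
    {l : Filter ι} [l.IsCountablyGenerated] {F : ι → α → ℂ} {g : α → ℂ} (hg : MemLp g 2 μ)
    (hF : ∀ᶠ i in l, AEStronglyMeasurable (F i) μ)
    (hb : ∀ᶠ i in l, ∀ᵐ x ∂μ, ‖F i x‖ ≤ ‖g x‖)
    (hlim : ∀ᵐ x ∂μ, Tendsto (fun i => F i x) l (𝓝 0)) :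
    Tendsto (fun i => eLpNorm (F i) 2 μ) l (𝓝 0) := by
  have key : ∀ f : α → ℂ, eLpNorm f 2 μ = (∫⁻ x, ‖f x‖ₑ ^ (2 : ℝ) ∂μ) ^ (1 / 2 : ℝ) := fun f => by
    rw [eLpNorm_eq_lintegral_rpow_enorm_toReal (by norm_num) (by norm_num)]
    norm_num
  have hfin : ∫⁻ x, ‖g x‖ₑ ^ (2 : ℝ) ∂μ ≠ ∞ := by
    have := lintegral_rpow_enorm_lt_top_of_eLpNorm_lt_top (p := 2) (by norm_num) (by norm_num)
      hg.eLpNorm_lt_top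
    simpa using this.ne
  have h0 : Tendsto (fun i => ∫⁻ x, ‖F i x‖ₑ ^ (2 : ℝ) ∂μ) l (𝓝 (∫⁻ _, 0 ∂μ)) := by
    refine tendsto_lintegral_filter_of_dominated_convergence' (fun x => ‖g x‖ₑ ^ (2 : ℝ))
      ?_ ?_ hfin ?_
    · filter_upwards [hF] with i hi
      exact hi.enorm.pow_const _
    · filter_upwards [hb] with i hi
      filter_upwards [hi] with x hx
      gcongr
      exact enorm_le_iff_norm_le.2 hx
    · filter_upwards [hlim] with x hx
      have h1 : Tendsto (fun i => ‖F i x‖ₑ) l (𝓝 0) := by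
        simpa [Function.comp_def] using (continuous_enorm.tendsto (0 : ℂ)).comp hx
      have := (ENNReal.continuous_rpow_const (y := 2)).tendsto 0 |>.comp h1
      simpa [Function.comp_def] using this
  have := (ENNReal.continuous_rpow_const (y := 1 / 2)).tendsto _ |>.comp h0
  simp only [key]
  simpa [Function.comp_def] using this

/-- An element of `Lp` is determined only off a null set depending on `i`, so for a continuous
parameter pointwise convergence is meaningless for chosen representatives. The explicit
representatives `G i` carry the pointwise limit instead; the bound is needed only for each `i`
separately. -/
theorem tendsto_Lp_two_of_dominated {α ι : Type*} [MeasurableSpace α] {μ : Measure α}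
    {l : Filter ι} [l.IsCountablyGenerated] {F : ι → Lp ℂ 2 μ} {F₀ : Lp ℂ 2 μ} {g : α → ℂ}
    (hg : MemLp g 2 μ)
    (hb : ∀ᶠ i in l, ∀ᵐ x ∂μ, ‖F i x - F₀ x‖ ≤ ‖g x‖) {G : ι → α → ℂ}
    (hG : ∀ᶠ i in l, F i - F₀ =ᵐ[μ] G i)
    (hlim : ∀ᵐ x ∂μ, Tendsto (fun i => G i x) l (𝓝 0)) :
    Tendsto F l (𝓝 F₀) := by
  rw [Lp.tendsto_Lp_iff_tendsto_eLpNorm']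
  have h : Tendsto (fun i => eLpNorm (G i) 2 μ) l (𝓝 0) := by
    refine tendsto_eLpNorm_two_of_dominated hg ?_ ?_ hlim
    · filter_upwards [hG] with i hi
      exact (Lp.aestronglyMeasurable (F i - F₀)).congr hi
    · filter_upwards [hb, hG] with i hi hi'
      filter_upwards [hi, hi', Lp.coeFn_sub (F i) F₀] with x hx hx' hs
      rw [← hx', hs]
      exact hx
  refine h.congr' ?_
  filter_upwards [hG] with i hi
  exact (eLpNorm_congr_ae ((Lp.coeFn_sub _ _).symm.trans hi)).symm

/-! ### Multiplication operators between weighted `L²` spaces -/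

/-- Multiplication by `m` as a contraction from `L²(μ)` to `L²(ν)`. -/
def mulLp {α : Type*} [MeasurableSpace α] {μ ν : Measure α} (m : α → ℂ) (hνμ : ν ≪ μ)
    (hm : AEStronglyMeasurable m ν)
    (hb : ∀ g : α → ℂ, eLpNorm (fun x => m x * g x) 2 ν ≤ eLpNorm g 2 μ) :
    Lp ℂ 2 μ →L[ℂ] Lp ℂ 2 ν :=
  have hmem : ∀ g : Lp ℂ 2 μ, MemLp (fun x => m x * g x) 2 ν := fun g =>
    ⟨hm.mul ((Lp.aestronglyMeasurable g).mono_ac hνμ), (hb g).trans_lt (Lp.eLpNorm_lt_top g)⟩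
  LinearMap.mkContinuous
    { toFun := fun g => (hmem g).toLp
      map_add' := fun f g => by
        rw [← MemLp.toLp_add]
        refine MemLp.toLp_congr _ _ ?_
        filter_upwards [hνμ.ae_le (Lp.coeFn_add f g)] with x hx
        simp only [hx, Pi.add_apply, mul_add]
      map_smul' := fun c f => by
        rw [RingHom.id_apply, ← MemLp.toLp_const_smul]
        refine MemLp.toLp_congr _ _ ?_
        filter_upwards [hνμ.ae_le (Lp.coeFn_smul c f)] with x hx
        simp only [hx, Pi.smul_apply, smul_eq_mul, mul_left_comm] }
    1 fun g => by
      rw [one_mul]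
      change ‖(hmem g).toLp‖ ≤ _
      rw [Lp.norm_toLp, Lp.norm_def]
      exact ENNReal.toReal_mono (Lp.eLpNorm_ne_top g) (hb g)

theorem coeFn_mulLp {α : Type*} [MeasurableSpace α] {μ ν : Measure α} {m : α → ℂ} (hνμ : ν ≪ μ)
    (hm : AEStronglyMeasurable m ν)
    (hb : ∀ g : α → ℂ, eLpNorm (fun x => m x * g x) 2 ν ≤ eLpNorm g 2 μ) (g : Lp ℂ 2 μ) :
    mulLp m hνμ hm hb g =ᵐ[ν] fun x => m x * g x :=
  MemLp.coeFn_toLp (f := fun x => m x * g x)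
    ⟨hm.mul ((Lp.aestronglyMeasurable g).mono_ac hνμ), (hb g).trans_lt (Lp.eLpNorm_lt_top g)⟩

/-! ### Sobolev measures -/

variable {d : ℕ}

theorem symbol_pos (ξ : EuclideanSpace ℝ (Fin d)) : 0 < symbol ξ :=
  zero_lt_one.trans_le (one_le_symbol ξ)

theorem sobolevMeasure_absolutelyContinuous (d : ℕ) (s : ℝ) : sobolevMeasure d s ≪ volume :=
  withDensity_absolutelyContinuous _ _

theorem continuous_symbol_rpow (s : ℝ) :
    Continuous fun ξ : EuclideanSpace ℝ (Fin d) => symbol ξ ^ s :=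
  continuous_symbol.rpow_const fun ξ => Or.inl (symbol_pos ξ).ne'

theorem measurable_sobolevDensity (d : ℕ) (s : ℝ) :
    Measurable fun ξ : EuclideanSpace ℝ (Fin d) => ENNReal.ofReal (symbol ξ ^ (2 * s)) :=
  (continuous_symbol_rpow (2 * s)).measurable.ennreal_ofReal

theorem absolutelyContinuous_sobolevMeasure (d : ℕ) (s : ℝ) : volume ≪ sobolevMeasure d s := by
  refine withDensity_absolutelyContinuous' (measurable_sobolevDensity d s).aemeasurable
    (Eventually.of_forall fun ξ => ?_)
  simpa using Real.rpow_pos_of_pos (symbol_pos ξ) _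

theorem eLpNorm_sobolevMeasure (s : ℝ) (f : EuclideanSpace ℝ (Fin d) → ℂ) :
    eLpNorm f 2 (sobolevMeasure d s) =
      eLpNorm (fun ξ => ((symbol ξ ^ s : ℝ) : ℂ) * f ξ) 2 volume := by
  rw [eLpNorm_eq_lintegral_rpow_enorm_toReal (by norm_num) (by norm_num),
    eLpNorm_eq_lintegral_rpow_enorm_toReal (by norm_num) (by norm_num), sobolevMeasure,
    lintegral_withDensity_eq_lintegral_mul_non_measurable _ (measurable_sobolevDensity d s)
      (Eventually.of_forall fun _ => ENNReal.ofReal_lt_top)]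
  congr 2
  ext ξ
  rw [Pi.mul_apply, enorm_mul, ENNReal.mul_rpow_of_nonneg _ _ (by norm_num)]
  congr 1
  have h := Real.rpow_pos_of_pos (symbol_pos ξ) s
  rw [show ‖((symbol ξ ^ s : ℝ) : ℂ)‖ₑ = ENNReal.ofReal (symbol ξ ^ s) by
    rw [← ofReal_norm, Complex.norm_real, Real.norm_of_nonneg h.le],
    ENNReal.ofReal_rpow_of_pos h, ← Real.rpow_mul (symbol_pos ξ).le, ENNReal.toReal_ofNat,
    mul_comm 2 s]

/-- The weights match because `-1/2 + 1 = 1/2`; this makes `⟨∇⟩` an isometry from `H^{1/2}` into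
`H^{-1/2}`. -/
theorem eLpNorm_symbol_mul (f : EuclideanSpace ℝ (Fin d) → ℂ) :
    eLpNorm (fun ξ => (symbol ξ : ℂ) * f ξ) 2 (sobolevMeasure d (-(1 / 2))) =
      eLpNorm f 2 (sobolevMeasure d (1 / 2)) := by
  rw [eLpNorm_sobolevMeasure, eLpNorm_sobolevMeasure]
  congr 1
  ext ξ
  rw [← mul_assoc, ← Complex.ofReal_mul]
  congr 2
  nth_rw 2 [← Real.rpow_one (symbol ξ)]
  rw [← Real.rpow_add (symbol_pos ξ)]
  norm_num

theorem sobolevMeasure_zero (d : ℕ) : sobolevMeasure d 0 = volume := by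
  simp [sobolevMeasure]

theorem volume_le_sobolevMeasure (d : ℕ) {s : ℝ} (hs : 0 ≤ s) : volume ≤ sobolevMeasure d s := by
  simpa [sobolevMeasure_zero] using sobolevMeasure_mono d hs

/-- The densities are strictly positive, so all these measures have the Lebesgue null sets, and
almost-everywhere identities pass freely between Sobolev scales. -/
theorem sobolevMeasure_ac (d : ℕ) (s r : ℝ) : sobolevMeasure d s ≪ sobolevMeasure d r :=
  (sobolevMeasure_absolutelyContinuous d s).trans (absolutelyContinuous_sobolevMeasure d r)

/-! ### The free evolution and the generator on the Sobolev scale -/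

/-- `⟨∇⟩` as an operator from `H^{1/2}` to `H^{-1/2}`. -/
def sobolevGenerator (d : ℕ) : Sobolev d (1 / 2) →L[ℂ] Sobolev d (-(1 / 2)) :=
  mulLp (fun ξ => (symbol ξ : ℂ)) (sobolevMeasure_ac d _ _)
    (Complex.continuous_ofReal.comp continuous_symbol).aestronglyMeasurable
    fun g => (eLpNorm_symbol_mul g).le

theorem norm_exp_symbol (t : ℝ) (ξ : EuclideanSpace ℝ (Fin d)) :
    ‖Complex.exp (-Complex.I * t * symbol ξ)‖ = 1 := by
  rw [Complex.norm_exp]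
  simp

theorem continuous_exp_symbol (t : ℝ) :
    Continuous fun ξ : EuclideanSpace ℝ (Fin d) => Complex.exp (-Complex.I * t * symbol ξ) := by
  have := continuous_symbol (d := d)
  fun_prop

/-- `exp(-it⟨∇⟩)` as an operator on `Hˢ`. -/
def sobolevEvolution (d : ℕ) (s t : ℝ) : Sobolev d s →L[ℂ] Sobolev d s :=
  mulLp (fun ξ => Complex.exp (-Complex.I * t * symbol ξ)) Measure.AbsolutelyContinuous.rfl
    (continuous_exp_symbol t).aestronglyMeasurable
    fun g => (eLpNorm_congr_norm_ae (Eventually.of_forall fun ξ => by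
      rw [norm_mul, norm_exp_symbol, one_mul])).le

theorem coeFn_sobolevGenerator (g : Sobolev d (1 / 2)) :
    sobolevGenerator d g =ᵐ[sobolevMeasure d (-(1 / 2))] fun ξ => (symbol ξ : ℂ) * g ξ :=
  coeFn_mulLp _ _ _ g

theorem coeFn_sobolevEvolution (s t : ℝ) (g : Sobolev d s) :
    sobolevEvolution d s t g =ᵐ[sobolevMeasure d s]
      fun ξ => Complex.exp (-Complex.I * t * symbol ξ) * g ξ :=
  coeFn_mulLp _ _ _ g

theorem coeFn_sobolevIncl (g : Sobolev d (1 / 2)) :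
    sobolevIncl d g =ᵐ[sobolevMeasure d (-(1 / 2))] g :=
  MemLp.coeFn_toLp _

theorem fourier_freeEvolution (t : ℝ) (ψ : L2 d) :
    (𝓕 (freeEvolution d t ψ) : L2 d) =ᵐ[volume]
      fun ξ => Complex.exp (-Complex.I * t * symbol ξ) * (𝓕 ψ : L2 d) ξ := by
  have h : (𝓕 (freeEvolution d t ψ) : L2 d) = mulOp _ (memLp_exp_symbol d t) (𝓕 ψ : L2 d) :=
    fourier_fourierInv_eq _
  rw [h]
  exact mulOp_apply _ _ _

theorem fourier_injective : Function.Injective (𝓕 : L2 d → L2 d) :=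
  Function.LeftInverse.injective fourierInv_fourier_eq

theorem freeEvolution_zero (d : ℕ) : freeEvolution d 0 = ContinuousLinearMap.id ℂ (L2 d) := by
  ext1 ψ
  refine fourier_injective (Lp.ext ?_)
  filter_upwards [fourier_freeEvolution 0 ψ] with ξ h
  rw [h]
  simp

theorem freeEvolution_comp (d : ℕ) (t s : ℝ) :
    freeEvolution d t ∘L freeEvolution d s = freeEvolution d (t + s) := by
  ext1 ψ
  refine fourier_injective (Lp.ext ?_)
  filter_upwards [fourier_freeEvolution t (freeEvolution d s ψ), fourier_freeEvolution s ψ,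
    fourier_freeEvolution (t + s) ψ] with ξ h1 h2 h3
  rw [ContinuousLinearMap.comp_apply, h1, h2, h3, ← mul_assoc, ← Complex.exp_add]
  push_cast
  ring_nf

theorem norm_freeEvolution (t : ℝ) (ψ : L2 d) : ‖freeEvolution d t ψ‖ = ‖ψ‖ := by
  rw [← Lp.norm_fourier_eq, ← Lp.norm_fourier_eq ψ, Lp.norm_def, Lp.norm_def]
  congr 1
  refine eLpNorm_congr_norm_ae ?_
  filter_upwards [fourier_freeEvolution t ψ] with ξ h
  rw [h, norm_mul, norm_exp_symbol, one_mul]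

/-- Being isometric makes the adjoint a left inverse; the evolution by `-t` is a right inverse. The
two must coincide. -/
theorem freeEvolution_mem_unitary (d : ℕ) (t : ℝ) :
    freeEvolution d t ∈ unitary (L2 d →L[ℂ] L2 d) := by
  have h1 : star (freeEvolution d t) * freeEvolution d t = 1 :=
    (ContinuousLinearMap.norm_map_iff_adjoint_comp_self _).1 (norm_freeEvolution t)
  have h2 : freeEvolution d t * freeEvolution d (-t) = 1 := by
    change freeEvolution d t ∘L freeEvolution d (-t) = _
    rw [freeEvolution_comp, add_neg_cancel, freeEvolution_zero]
    rfl
  refine Unitary.mem_iff.2 ⟨h1, ?_⟩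
  rwa [left_inv_eq_right_inv h1 h2]

theorem tendsto_sobolevEvolution (s t₀ : ℝ) (g : Sobolev d s) :
    Tendsto (fun t => sobolevEvolution d s t g) (𝓝 t₀) (𝓝 (sobolevEvolution d s t₀ g)) := by
  have hG : ∀ t, (sobolevEvolution d s t g - sobolevEvolution d s t₀ g : Sobolev d s)
      =ᵐ[sobolevMeasure d s] fun ξ => (Complex.exp (-Complex.I * t * symbol ξ) -
        Complex.exp (-Complex.I * t₀ * symbol ξ)) * g ξ := fun t => by
    filter_upwards [Lp.coeFn_sub (sobolevEvolution d s t g) (sobolevEvolution d s t₀ g),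
      coeFn_sobolevEvolution s t g, coeFn_sobolevEvolution s t₀ g] with ξ h h1 h2
    rw [h, Pi.sub_apply, h1, h2, sub_mul]
  refine tendsto_Lp_two_of_dominated ((Lp.memLp g).const_mul 2) (Eventually.of_forall fun t => ?_)
    (Eventually.of_forall hG) (Eventually.of_forall fun ξ => ?_)
  · filter_upwards [coeFn_sobolevEvolution s t g, coeFn_sobolevEvolution s t₀ g] with ξ h1 h2
    rw [h1, h2, ← sub_mul, norm_mul, norm_mul]
    gcongr
    refine (norm_sub_le _ _).trans ?_
    rw [norm_exp_symbol, norm_exp_symbol]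
    norm_num
  · have : Continuous fun t : ℝ => (Complex.exp (-Complex.I * t * symbol ξ) -
        Complex.exp (-Complex.I * t₀ * symbol ξ)) * g ξ := by fun_prop
    simpa using this.tendsto t₀

theorem norm_exp_mul_I_sub_one_le (x : ℝ) : ‖Complex.exp (-Complex.I * x) - 1‖ ≤ |x| := by
  have := Real.norm_exp_I_mul_ofReal_sub_one_le (x := -x)
  simpa using this

/-- Difference quotients of `exp(-iτ⟨ξ⟩)` are bounded by `⟨ξ⟩` uniformly in `τ`, and so is the
derivative. Thus `2⟨ξ⟩g` dominates, and it is square integrable precisely in the `H^{-1/2}` weight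
when `g ∈ H^{1/2}`. -/
theorem hasDerivAt_sobolevEvolution (t : ℝ) (g : Sobolev d (1 / 2)) :
    HasDerivAt (fun τ => sobolevIncl d (sobolevEvolution d (1 / 2) τ g))
      (-Complex.I • sobolevGenerator d (sobolevEvolution d (1 / 2) t g)) t := by
  rw [hasDerivAt_iff_tendsto_slope]
  have hae := (sobolevMeasure_ac d (-(1 / 2)) (1 / 2)).ae_le
  have hincl : ∀ τ, sobolevIncl d (sobolevEvolution d (1 / 2) τ g)
      =ᵐ[sobolevMeasure d (-(1 / 2))]
      fun ξ => Complex.exp (-Complex.I * τ * symbol ξ) * g ξ := fun τ => by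
    filter_upwards [coeFn_sobolevIncl (sobolevEvolution d (1 / 2) τ g),
      hae (coeFn_sobolevEvolution (1 / 2) τ g)] with ξ h1 h2
    rw [h1, h2]
  have hgen : (-Complex.I • sobolevGenerator d (sobolevEvolution d (1 / 2) t g) :
      Sobolev d (-(1 / 2))) =ᵐ[sobolevMeasure d (-(1 / 2))]
      fun ξ => -Complex.I * symbol ξ * (Complex.exp (-Complex.I * t * symbol ξ) * g ξ) := by
    filter_upwards [Lp.coeFn_smul (-Complex.I)
      (sobolevGenerator d (sobolevEvolution d (1 / 2) t g)),
      coeFn_sobolevGenerator (sobolevEvolution d (1 / 2) t g),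
      hae (coeFn_sobolevEvolution (1 / 2) t g)] with ξ h1 h2 h3
    rw [h1, Pi.smul_apply, h2, h3, smul_eq_mul, ← mul_assoc]
  have hslope : ∀ τ, (slope (fun τ => sobolevIncl d (sobolevEvolution d (1 / 2) τ g)) t τ :
      Sobolev d (-(1 / 2))) =ᵐ[sobolevMeasure d (-(1 / 2))]
      fun ξ => slope (fun τ : ℝ => Complex.exp (-Complex.I * τ * symbol ξ)) t τ * g ξ :=
    fun τ => by
    rw [slope_def_module]
    filter_upwards [Lp.coeFn_smul (τ - t)⁻¹ (sobolevIncl d (sobolevEvolution d (1 / 2) τ g) -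
        sobolevIncl d (sobolevEvolution d (1 / 2) t g)),
      Lp.coeFn_sub (sobolevIncl d (sobolevEvolution d (1 / 2) τ g))
        (sobolevIncl d (sobolevEvolution d (1 / 2) t g)), hincl τ, hincl t] with ξ h1 h2 h3 h4
    rw [h1, Pi.smul_apply, h2, Pi.sub_apply, h3, h4, slope_def_module, ← sub_mul, smul_mul_assoc]
  have hmem : MemLp (fun ξ => 2 * ((symbol ξ : ℂ) * g ξ)) 2 (sobolevMeasure d (-(1 / 2))) :=
    ((memLp_congr_ae (coeFn_sobolevGenerator g)).1 (Lp.memLp _)).const_mul 2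
  have hdiff : ∀ τ, (slope (fun τ => sobolevIncl d (sobolevEvolution d (1 / 2) τ g)) t τ -
      -Complex.I • sobolevGenerator d (sobolevEvolution d (1 / 2) t g) : Sobolev d (-(1 / 2)))
      =ᵐ[sobolevMeasure d (-(1 / 2))]
      fun ξ => (slope (fun τ : ℝ => Complex.exp (-Complex.I * τ * symbol ξ)) t τ -
        -Complex.I * symbol ξ * Complex.exp (-Complex.I * t * symbol ξ)) * g ξ := fun τ => by
    filter_upwards [Lp.coeFn_sub
      (slope (fun τ => sobolevIncl d (sobolevEvolution d (1 / 2) τ g)) t τ)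
      (-Complex.I • sobolevGenerator d (sobolevEvolution d (1 / 2) t g)), hslope τ, hgen]
      with ξ h1 h2 h3
    rw [h1, Pi.sub_apply, h2, h3]
    ring
  have hslope_le : ∀ (τ : ℝ) (ξ : EuclideanSpace ℝ (Fin d)),
      ‖slope (fun τ : ℝ => Complex.exp (-Complex.I * τ * symbol ξ)) t τ‖ ≤ symbol ξ :=
    fun τ ξ => by
    have h : Complex.exp (-Complex.I * τ * symbol ξ) - Complex.exp (-Complex.I * t * symbol ξ) =
        Complex.exp (-Complex.I * t * symbol ξ) *
          (Complex.exp (-Complex.I * ((τ - t) * symbol ξ : ℝ)) - 1) := by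
      rw [mul_sub, ← Complex.exp_add, mul_one]
      push_cast
      ring_nf
    rw [slope_def_module, h, norm_smul, norm_mul, norm_exp_symbol, one_mul, norm_inv,
      Real.norm_eq_abs]
    -- At `τ = t` the slope is zero by the convention `0⁻¹ = 0`.
    rcases eq_or_ne τ t with rfl | hne
    · simpa using (symbol_pos ξ).le
    · rw [inv_mul_le_iff₀ (abs_pos.2 (sub_ne_zero.2 hne))]
      refine (norm_exp_mul_I_sub_one_le _).trans ?_
      rw [abs_mul, abs_of_pos (symbol_pos ξ)]
  refine tendsto_Lp_two_of_dominated hmem (Eventually.of_forall fun τ => ?_)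
    (Eventually.of_forall hdiff) (Eventually.of_forall fun ξ => ?_)
  · filter_upwards [hslope τ, hgen] with ξ h1 h2
    rw [h1, h2, ← mul_assoc, ← sub_mul, ← mul_assoc, norm_mul, norm_mul]
    gcongr
    refine (norm_sub_le _ _).trans ?_
    rw [norm_mul, norm_exp_symbol, mul_one, norm_mul, norm_mul, norm_neg, Complex.norm_I, one_mul,
      Complex.norm_real, Real.norm_of_nonneg (symbol_pos ξ).le, Complex.norm_two, two_mul]
    gcongr
    exact hslope_le τ ξ
  · have h : HasDerivAt (fun τ : ℝ => Complex.exp (-Complex.I * τ * symbol ξ))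
        (-Complex.I * symbol ξ * Complex.exp (-Complex.I * t * symbol ξ)) t := by
      have h1 : HasDerivAt (fun τ : ℝ => -Complex.I * τ * symbol ξ) (-Complex.I * symbol ξ) t := by
        simpa using ((Complex.ofRealCLM.hasDerivAt (x := t)).const_mul (-Complex.I)).mul_const
          (symbol ξ : ℂ)
      simpa [mul_comm] using h1.cexp
    have := ((hasDerivAt_iff_tendsto_slope.1 h).sub_const
      (-Complex.I * symbol ξ * Complex.exp (-Complex.I * t * symbol ξ))).mul_const (g ξ)
    simpa using this

/-! ### Self-adjointness of the generator -/

theorem memLp_indicator_closedBall {μ : Measure (EuclideanSpace ℝ (Fin d))} (g : Lp ℂ 2 μ)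
    (r : ℝ) : MemLp ((Metric.closedBall 0 r).indicator g) 2 μ :=
  (Lp.memLp g).indicator Metric.isClosed_closedBall.measurableSet

/-- Cutting off high frequencies approximates the elements of `L²(μ)`. -/
theorem tendsto_indicator_closedBall {μ : Measure (EuclideanSpace ℝ (Fin d))} (g : Lp ℂ 2 μ) :
    Tendsto (fun n : ℕ => (memLp_indicator_closedBall g n).toLp) atTop (𝓝 g) := by
  have hG : ∀ n : ℕ, ((memLp_indicator_closedBall g n).toLp - g : Lp ℂ 2 μ)
      =ᵐ[μ] fun ξ => (Metric.closedBall 0 (n : ℝ)).indicator g ξ - g ξ :=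
    fun n => by
    filter_upwards [Lp.coeFn_sub (memLp_indicator_closedBall g n).toLp g,
      (memLp_indicator_closedBall g n).coeFn_toLp] with ξ h1 h2
    rw [h1, Pi.sub_apply, h2]
  refine tendsto_Lp_two_of_dominated (Lp.memLp g) (Eventually.of_forall fun n => ?_)
    (Eventually.of_forall hG) (Eventually.of_forall fun ξ => ?_)
  · filter_upwards [(memLp_indicator_closedBall g n).coeFn_toLp] with ξ h
    rw [h]
    by_cases hξ : ξ ∈ Metric.closedBall (0 : EuclideanSpace ℝ (Fin d)) n <;> simp [hξ]
  · refine tendsto_const_nhds.congr' ?_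
    obtain ⟨N, hN⟩ := exists_nat_ge ‖ξ‖
    filter_upwards [eventually_ge_atTop N] with n hn
    have : ξ ∈ Metric.closedBall (0 : EuclideanSpace ℝ (Fin d)) n := by
      rw [mem_closedBall_zero_iff]
      exact hN.trans (by exact_mod_cast hn)
    simp [this]

theorem symbol_le {r : ℝ} {ξ : EuclideanSpace ℝ (Fin d)}
    (hξ : ξ ∈ Metric.closedBall (0 : EuclideanSpace ℝ (Fin d)) r) :
    symbol ξ ≤ √(1 + (2 * Real.pi * r) ^ 2) := by
  unfold symbol
  rw [mem_closedBall_zero_iff] at hξ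
  gcongr

theorem toLp_indicator_mem_symbolDomain {f : EuclideanSpace ℝ (Fin d) → ℂ}
    (hf : MemLp f 2 volume) (r : ℝ)
    (hr : MemLp ((Metric.closedBall 0 r).indicator f) 2 volume) :
    hr.toLp ∈ symbolDomain d := by
  change MemLp (fun ξ => (symbol ξ : ℂ) * (hr.toLp : L2 d) ξ) 2 volume
  refine (hf.const_mul (√(1 + (2 * Real.pi * r) ^ 2) : ℂ)).mono
    ((Complex.continuous_ofReal.comp continuous_symbol).aestronglyMeasurable.mul
      (Lp.aestronglyMeasurable _)) ?_
  filter_upwards [hr.coeFn_toLp] with ξ h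
  rw [h]
  by_cases hξ : ξ ∈ Metric.closedBall (0 : EuclideanSpace ℝ (Fin d)) r
  · rw [Set.indicator_of_mem hξ, norm_mul, norm_mul, Complex.norm_real, Complex.norm_real,
      Real.norm_of_nonneg (symbol_pos ξ).le, Real.norm_of_nonneg (Real.sqrt_nonneg _)]
    gcongr
    exact symbol_le hξ
  · rw [Set.indicator_of_notMem hξ, mul_zero, norm_zero]
    positivity

theorem mem_japaneseOp_domain {ψ : L2 d} :
    ψ ∈ (japaneseOp d).domain ↔ (𝓕 ψ : L2 d) ∈ symbolDomain d :=
  Iff.rfl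

theorem fourier_japaneseOp (ψ : (japaneseOp d).domain) :
    (𝓕 (japaneseOp d ψ) : L2 d) =ᵐ[volume] fun ξ => (symbol ξ : ℂ) * (𝓕 (ψ : L2 d) : L2 d) ξ := by
  have h : (𝓕 (japaneseOp d ψ) : L2 d) = symbolMul d ⟨𝓕 (ψ : L2 d), ψ.2⟩ :=
    fourier_fourierInv_eq _
  rw [h]
  exact MemLp.coeFn_toLp (mem_symbolDomain ⟨𝓕 (ψ : L2 d), ψ.2⟩)

/-- The elements of `H^{1/2}` that belong to the domain of `⟨∇⟩` are dense. -/
theorem dense_sobolev_japaneseOp_domain (d : ℕ) {s : ℝ} (hs : 0 ≤ s) :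
    Dense {g : Sobolev d s | ∃ ψ : (japaneseOp d).domain, SameDistribution (ψ : L2 d) g} := by
  intro g
  refine mem_closure_of_tendsto (tendsto_indicator_closedBall g) (Eventually.of_forall fun n => ?_)
  have hg : MemLp g 2 volume := (Lp.memLp g).mono_measure (volume_le_sobolevMeasure d hs)
  have hr : MemLp ((Metric.closedBall 0 (n : ℝ)).indicator g) 2 volume :=
    hg.indicator Metric.isClosed_closedBall.measurableSet
  have hF : (𝓕 (𝓕⁻ hr.toLp : L2 d) : L2 d) = hr.toLp := fourier_fourierInv_eq _
  refine ⟨⟨𝓕⁻ hr.toLp, ?_⟩, ?_⟩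
  · rw [mem_japaneseOp_domain, hF]
    exact toLp_indicator_mem_symbolDomain hg n hr
  · change (𝓕 (𝓕⁻ hr.toLp : L2 d) : L2 d) =ᵐ[volume] _
    rw [hF]
    filter_upwards [hr.coeFn_toLp, (absolutelyContinuous_sobolevMeasure d s).ae_le
      (memLp_indicator_closedBall g n).coeFn_toLp] with ξ h1 h2
    rw [h1, h2]

theorem dense_japaneseOp_domain (d : ℕ) : Dense ((japaneseOp d).domain : Set (L2 d)) := by
  have hD : Dense (symbolDomain d : Set (L2 d)) := by
    intro g
    exact mem_closure_of_tendsto (tendsto_indicator_closedBall g)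
      (Eventually.of_forall fun n => toLp_indicator_mem_symbolDomain (Lp.memLp g) n _)
  exact hD.preimage (Lp.fourierTransformₗᵢ (EuclideanSpace ℝ (Fin d)) ℂ).toHomeomorph.isOpenMap

theorem inner_japaneseOp (ψ φ : (japaneseOp d).domain) :
    inner ℂ (japaneseOp d ψ) (φ : L2 d) = inner ℂ (ψ : L2 d) (japaneseOp d φ) := by
  rw [← Lp.inner_fourier_eq, ← Lp.inner_fourier_eq (ψ : L2 d), L2.inner_def, L2.inner_def]
  refine integral_congr_ae ?_
  filter_upwards [fourier_japaneseOp ψ, fourier_japaneseOp φ] with ξ h1 h2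
  rw [h1, h2]
  simp only [RCLike.inner_apply, map_mul, Complex.conj_ofReal]
  ring

theorem memLp_symbol_inv_mul (f : L2 d) :
    MemLp (fun ξ => ((symbol ξ)⁻¹ : ℂ) * f ξ) 2 volume := by
  refine (Lp.memLp f).mono ?_ (Eventually.of_forall fun ξ => ?_)
  · refine AEStronglyMeasurable.mul ?_ (Lp.aestronglyMeasurable f)
    refine (Continuous.inv₀ (Complex.continuous_ofReal.comp continuous_symbol)
      fun ξ => ?_).aestronglyMeasurable
    exact Complex.ofReal_ne_zero.2 (symbol_pos ξ).ne'
  · rw [norm_mul, norm_inv, Complex.norm_real, Real.norm_of_nonneg (symbol_pos ξ).le]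
    exact mul_le_of_le_one_left (norm_nonneg _) (inv_le_one_of_one_le₀ (one_le_symbol ξ))

/-- Symmetry gives one inclusion. For the other, since `⟨ξ⟩ ≥ 1`, every `h ∈ L²` is the Fourier
transform of an element of the range. Testing the adjoint relation for `w = A*y` against all `h`
gives `𝓕y = ⟨ξ⟩⁻¹𝓕w`, which puts `y` in the domain. -/
theorem isSelfAdjoint_japaneseOp (d : ℕ) : IsSelfAdjoint (japaneseOp d) := by
  have hdense := dense_japaneseOp_domain d
  have hle : japaneseOp d ≤ (japaneseOp d).adjoint :=
    LinearPMap.IsFormalAdjoint.le_adjoint hdense fun ψ φ => inner_japaneseOp ψ φ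
  refine LinearPMap.isSelfAdjoint_def.2 (LinearPMap.eq_of_le_of_domain_eq hle
    (le_antisymm hle.1 fun y hy => ?_)).symm
  set w : L2 d := (japaneseOp d).adjoint ⟨y, hy⟩ with hw
  have hadj : ∀ ψ : (japaneseOp d).domain,
      inner ℂ w (ψ : L2 d) = inner ℂ y (japaneseOp d ψ) := fun ψ =>
    LinearPMap.adjoint_isFormalAdjoint hdense ⟨y, hy⟩ ψ
  have hne : ∀ ξ : EuclideanSpace ℝ (Fin d), (symbol ξ : ℂ) ≠ 0 := fun ξ =>
    Complex.ofReal_ne_zero.2 (symbol_pos ξ).ne'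
  have hy : (memLp_symbol_inv_mul (𝓕 w : L2 d)).toLp = (𝓕 y : L2 d) := by
    refine ext_inner_right ℂ fun h => ?_
    have hF : (𝓕 (𝓕⁻ (memLp_symbol_inv_mul h).toLp : L2 d) : L2 d) =
      (memLp_symbol_inv_mul h).toLp := fourier_fourierInv_eq _
    have hmul : (fun ξ => (symbol ξ : ℂ) * ((memLp_symbol_inv_mul h).toLp : L2 d) ξ) =ᵐ[volume] h := by
      filter_upwards [(memLp_symbol_inv_mul h).coeFn_toLp] with ξ h1
      rw [h1, mul_inv_cancel_left₀ (hne ξ)]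
    let ψ : (japaneseOp d).domain := ⟨𝓕⁻ (memLp_symbol_inv_mul h).toLp, by
      rw [mem_japaneseOp_domain, hF]
      exact (memLp_congr_ae hmul).2 (Lp.memLp h)⟩
    have hψ : (𝓕 (japaneseOp d ψ) : L2 d) = h := by
      refine Lp.ext ((fourier_japaneseOp ψ).trans ?_)
      change (fun ξ => (symbol ξ : ℂ) * (𝓕 (𝓕⁻ (memLp_symbol_inv_mul h).toLp : L2 d) : L2 d) ξ)
        =ᵐ[volume] h
      rw [hF]
      exact hmul
    calc inner ℂ (memLp_symbol_inv_mul (𝓕 w : L2 d)).toLp h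
        = inner ℂ (𝓕 w : L2 d) (memLp_symbol_inv_mul h).toLp := by
          rw [L2.inner_def, L2.inner_def]
          refine integral_congr_ae ?_
          filter_upwards [(memLp_symbol_inv_mul h).coeFn_toLp,
            (memLp_symbol_inv_mul (𝓕 w : L2 d)).coeFn_toLp] with ξ h1 h2
          rw [h1, h2]
          simp only [RCLike.inner_apply, map_mul, map_inv₀, Complex.conj_ofReal]
          ring
      _ = inner ℂ (𝓕 w : L2 d) (𝓕 (ψ : L2 d) : L2 d) := by rw [← hF]
      _ = inner ℂ y (japaneseOp d ψ) := by rw [Lp.inner_fourier_eq, hadj]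
      _ = inner ℂ (𝓕 y : L2 d) h := by rw [← Lp.inner_fourier_eq, hψ]
  rw [mem_japaneseOp_domain, ← hy]
  refine (memLp_congr_ae ?_).2 (Lp.memLp (𝓕 w : L2 d))
  filter_upwards [(memLp_symbol_inv_mul (𝓕 w : L2 d)).coeFn_toLp] with ξ h
  rw [h, mul_inv_cancel_left₀ (hne ξ)]

theorem isGenerator_japaneseOp (d : ℕ) : IsGenerator (japaneseOp d) (sobolevGenerator d) where
  selfAdjoint := isSelfAdjoint_japaneseOp d
  dense := dense_sobolev_japaneseOp_domain d (by norm_num)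
  extends_op := fun ψ g h => by
    refine (fourier_japaneseOp ψ).trans ?_
    filter_upwards [h, (absolutelyContinuous_sobolevMeasure d (-(1 / 2))).ae_le
      (coeFn_sobolevGenerator g)] with ξ h1 h2
    rw [h1, h2]

/-- The free evolution is a unitary propagator generated by `⟨∇⟩`. -/
theorem isUnitaryPropagator_freeEvolution (d : ℕ) (T : ℝ) :
    IsUnitaryPropagator T (fun _ => japaneseOp d) fun t s => freeEvolution d (t - s) where
  isUnitary := fun _ _ _ _ => freeEvolution_mem_unitary d _
  refl := fun t _ => by rw [sub_self, freeEvolution_zero]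
  comp := fun t _ s _ r _ => by rw [freeEvolution_comp, sub_add_sub_cancel]
  evolution := by
    have hcont : ∀ (s : ℝ) (g : Sobolev d (1 / 2)),
        Continuous fun t => sobolevEvolution d (1 / 2) (t - s) g := fun s g =>
      (continuous_iff_continuousAt.2 fun t => tendsto_sobolevEvolution (1 / 2) t g).comp
        (continuous_sub_right s)
    refine ⟨fun _ => sobolevGenerator d, fun _ _ => isGenerator_japaneseOp d, fun s _ =>
      ⟨fun t => sobolevEvolution d (1 / 2) (t - s), fun t _ ψ g h => ?_,
        fun g => (hcont s g).continuousOn, fun g t _ => ?_, fun g => ?_⟩⟩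
    · refine (fourier_freeEvolution (t - s) ψ).trans ?_
      filter_upwards [h, (absolutelyContinuous_sobolevMeasure d (1 / 2)).ae_le
        (coeFn_sobolevEvolution (1 / 2) (t - s) g)] with ξ h1 h2
      rw [h1, h2]
    · exact ((hasDerivAt_sobolevEvolution (t - s) g).comp_sub_const t s).hasDerivWithinAt
    · exact (((sobolevGenerator d).continuous.comp (hcont s g)).const_smul
        (-Complex.I)).continuousOn

/-! ### Wave packets of high momentum -/

open scoped ContDiff

/-- The wave packet `φ(x - s e) exp(2πiλ⟨e, x - s e⟩)`. -/
def wavePacket (φ : EuclideanSpace ℝ (Fin d) → ℂ) (e : EuclideanSpace ℝ (Fin d)) (l s : ℝ)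
    (x : EuclideanSpace ℝ (Fin d)) : ℂ :=
  Complex.exp (2 * Real.pi * l * inner ℝ e (x - s • e) * Complex.I) * φ (x - s • e)

theorem contDiff_wavePacket {φ : EuclideanSpace ℝ (Fin d) → ℂ} (hφ : ContDiff ℝ ∞ φ)
    (e : EuclideanSpace ℝ (Fin d)) (l s : ℝ) : ContDiff ℝ ∞ (wavePacket φ e l s) := by
  have h1 : ContDiff ℝ ∞ fun x : EuclideanSpace ℝ (Fin d) => x - s • e :=
    contDiff_id.sub contDiff_const
  have h2 : ContDiff ℝ ∞ fun x : EuclideanSpace ℝ (Fin d) => ((inner ℝ e (x - s • e) : ℝ) : ℂ) :=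
    Complex.ofRealCLM.contDiff.comp (contDiff_const.inner ℝ h1)
  exact ((contDiff_const.mul h2).mul contDiff_const).cexp.mul (hφ.comp h1)

theorem hasCompactSupport_wavePacket {φ : EuclideanSpace ℝ (Fin d) → ℂ}
    (hφ : HasCompactSupport φ) (e : EuclideanSpace ℝ (Fin d)) (l s : ℝ) :
    HasCompactSupport (wavePacket φ e l s) :=
  (hφ.comp_homeomorph (Homeomorph.subRight (s • e))).mul_left

/-- The wave packet as an element of `L²`. -/
def wavePacketLp {φ : EuclideanSpace ℝ (Fin d) → ℂ} (hφ : ContDiff ℝ ∞ φ)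
    (hc : HasCompactSupport φ) (e : EuclideanSpace ℝ (Fin d)) (l s : ℝ) : L2 d :=
  ((hasCompactSupport_wavePacket hc e l s).toSchwartzMap (contDiff_wavePacket hφ e l s)).toLp 2

section

variable {φ : EuclideanSpace ℝ (Fin d) → ℂ} (hφ : ContDiff ℝ ∞ φ) (hc : HasCompactSupport φ)
  (e : EuclideanSpace ℝ (Fin d))

theorem coeFn_wavePacketLp (l s : ℝ) :
    wavePacketLp hφ hc e l s =ᵐ[volume] wavePacket φ e l s :=
  SchwartzMap.coeFn_toLp _ 2 volume

theorem fourier_wavePacket (l s : ℝ) (ξ : EuclideanSpace ℝ (Fin d)) :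
    𝓕 (wavePacket φ e l s) ξ =
      Complex.exp (-2 * Real.pi * s * inner ℝ e ξ * Complex.I) * 𝓕 φ (ξ - l • e) := by
  -- The integral defining `𝓕 φ` is shifted by `s e`; the two integrands then agree pointwise.
  rw [Real.fourier_eq', Real.fourier_eq', ← integral_const_mul,
    ← integral_sub_right_eq_self (fun x => _ * (_ • φ x)) (s • e)]
  refine integral_congr_ae (Eventually.of_forall fun x => ?_)
  simp only [wavePacket, smul_eq_mul, ← mul_assoc, ← Complex.exp_add]
  congr 2
  have h1 : inner ℝ x ξ = inner ℝ (x - s • e) ξ + s * inner ℝ e ξ := by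
    rw [inner_sub_left, real_inner_smul_left]; ring
  rw [h1, inner_sub_right (x - s • e), real_inner_smul_right, real_inner_comm e]
  push_cast
  ring

theorem fourier_wavePacketLp (l s : ℝ) :
    (𝓕 (wavePacketLp hφ hc e l s) : L2 d) =ᵐ[volume] fun ξ =>
      Complex.exp (-2 * Real.pi * s * inner ℝ e ξ * Complex.I) * 𝓕 φ (ξ - l • e) := by
  rw [wavePacketLp, SchwartzMap.toLp_fourier_eq]
  refine (SchwartzMap.coeFn_toLp _ 2 volume).trans (Eventually.of_forall fun ξ => ?_)
  exact fourier_wavePacket e l s ξ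

theorem norm_wavePacketLp (l s : ℝ) :
    ‖wavePacketLp hφ hc e l s‖ = (eLpNorm φ 2 volume).toReal := by
  rw [Lp.norm_def, eLpNorm_congr_ae (coeFn_wavePacketLp hφ hc e l s)]
  congr 1
  rw [← eLpNorm_comp_measurePreserving (g := φ) hφ.continuous.aestronglyMeasurable
    (measurePreserving_sub_right volume (s • e))]
  refine eLpNorm_congr_norm_ae (Eventually.of_forall fun x => ?_)
  rw [wavePacket, norm_mul, Complex.norm_exp]
  simp

theorem tendsto_sqrt_sq_add_sub (K : ℝ) (hK : 0 ≤ K) :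
    Tendsto (fun b : ℝ => √(b ^ 2 + K) - b) atTop (𝓝 0) := by
  refine squeeze_zero' ?_ ?_ (tendsto_const_nhds.div_atTop (a := K) tendsto_id)
  · filter_upwards with b
    exact sub_nonneg.2 (Real.le_sqrt_of_sq_le (by linarith))
  · filter_upwards [eventually_gt_atTop 0] with b hb
    rw [sub_le_iff_le_add, id]
    refine Real.sqrt_le_iff.2 ⟨by positivity, ?_⟩
    have h : K / b * b = K := div_mul_cancel₀ _ hb.ne'
    nlinarith [sq_nonneg (K / b)]

/-- In the direction `e` the symbol is asymptotically linear with slope one. -/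
theorem tendsto_symbol_add_smul_sub (he : ‖e‖ = 1) (ξ : EuclideanSpace ℝ (Fin d)) :
    Tendsto (fun l : ℝ => symbol (ξ + l • e) - 2 * Real.pi * inner ℝ e (ξ + l • e)) atTop
      (𝓝 0) := by
  have hin : ∀ l : ℝ, inner ℝ e (ξ + l • e) = inner ℝ e ξ + l := fun l => by
    rw [inner_add_right, real_inner_smul_right, real_inner_self_eq_norm_sq, he]
    ring
  have hC : 0 ≤ ‖ξ‖ ^ 2 - (inner ℝ e ξ) ^ 2 := by
    have := abs_real_inner_le_norm e ξ
    rw [he, one_mul] at this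
    exact sub_nonneg.2 (sq_le_sq.2 (this.trans (le_abs_self _)))
  have hlim : Tendsto (fun l : ℝ => 2 * Real.pi * (inner ℝ e ξ + l)) atTop atTop :=
    (tendsto_atTop_add_const_left _ _ tendsto_id).const_mul_atTop (by positivity)
  -- The symbol is `√(b² + K)` with longitudinal part `b = 2π(⟨e, ξ⟩ + l)`. The constant `K`
  -- collects the mass and the part of `ξ` transversal to `e`, so it does not depend on `l`.
  refine ((tendsto_sqrt_sq_add_sub
    (1 + (2 * Real.pi) ^ 2 * (‖ξ‖ ^ 2 - (inner ℝ e ξ) ^ 2)) (by positivity)).comp hlim).congr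
    fun l => ?_
  simp only [Function.comp_apply, symbol, hin]
  congr 2
  rw [mul_pow _ ‖_‖, norm_add_sq_real, real_inner_smul_right, norm_smul, he, mul_one,
    Real.norm_eq_abs, sq_abs, real_inner_comm]
  ring

theorem norm_exp_sub_exp_le (x y : ℝ) :
    ‖Complex.exp (-Complex.I * x) - Complex.exp (-Complex.I * y)‖ ≤ |x - y| := by
  have h : Complex.exp (-Complex.I * x) - Complex.exp (-Complex.I * y) =
      Complex.exp (-Complex.I * y) * (Complex.exp (-Complex.I * (x - y : ℝ)) - 1) := by
    rw [mul_sub, ← Complex.exp_add, mul_one]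
    push_cast
    ring_nf
  rw [h, norm_mul, show ‖Complex.exp (-Complex.I * y)‖ = 1 by rw [Complex.norm_exp]; simp, one_mul]
  exact norm_exp_mul_I_sub_one_le _

/-- At high momentum the free evolution transports wave packets with speed one. -/
theorem tendsto_freeEvolution_wavePacket (he : ‖e‖ = 1) (t : ℝ) :
    Tendsto (fun l : ℝ => ‖freeEvolution d t (wavePacketLp hφ hc e l 0) -
      wavePacketLp hφ hc e l t‖) atTop (𝓝 0) := by
  let f : SchwartzMap (EuclideanSpace ℝ (Fin d)) ℂ := 𝓕 (hc.toSchwartzMap hφ)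
  have hf : ∀ ξ, 𝓕 φ ξ = f ξ := fun ξ => rfl
  let M : EuclideanSpace ℝ (Fin d) → ℂ := fun ξ =>
    Complex.exp (-Complex.I * (t * symbol ξ : ℝ)) -
      Complex.exp (-Complex.I * (t * (2 * Real.pi * inner ℝ e ξ) : ℝ))
  have hM : Continuous M := by
    have := continuous_symbol (d := d)
    fun_prop
  have hnorm : ∀ l : ℝ, ‖freeEvolution d t (wavePacketLp hφ hc e l 0) -
      wavePacketLp hφ hc e l t‖ = (eLpNorm (fun ξ => M (ξ + l • e) * f ξ) 2 volume).toReal := by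
    intro l
    rw [← Lp.norm_fourier_eq, sub_eq_add_neg, FourierTransform.fourier_add,
      FourierTransform.fourier_neg, ← sub_eq_add_neg,
      Lp.norm_def]
    congr 1
    have h : ((𝓕 (freeEvolution d t (wavePacketLp hφ hc e l 0)) -
        𝓕 (wavePacketLp hφ hc e l t) : L2 d)) =ᵐ[volume] fun ξ => M ξ * f (ξ - l • e) := by
      filter_upwards [Lp.coeFn_sub (𝓕 (freeEvolution d t (wavePacketLp hφ hc e l 0)) : L2 d)
        (𝓕 (wavePacketLp hφ hc e l t)), fourier_freeEvolution t (wavePacketLp hφ hc e l 0),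
        fourier_wavePacketLp hφ hc e l 0, fourier_wavePacketLp hφ hc e l t]
        with ξ h1 h2 h3 h4
      rw [h1, Pi.sub_apply, h2, h3, h4, hf]
      simp only [M, sub_mul]
      push_cast
      ring_nf
      simp
    -- Translating by `l e` moves the dependence on `l` from the profile `f` to the bounded phase
    -- difference `M`, so `2f` dominates for all `l`.
    rw [eLpNorm_congr_ae h, ← eLpNorm_comp_measurePreserving
      (g := fun ξ => M ξ * f (ξ - l • e))
      (hM.mul (f.continuous.comp (continuous_sub_right (l • e)))).aestronglyMeasurable
      (measurePreserving_add_right volume (l • e))]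
    congr 1
    ext ξ
    simp
  have hnormexp : ∀ x : ℝ, ‖Complex.exp (-Complex.I * x)‖ = 1 := fun x => by
    rw [Complex.norm_exp]; simp
  have hlim : Tendsto (fun l : ℝ => eLpNorm (fun ξ => M (ξ + l • e) * f ξ) 2 volume) atTop
      (𝓝 0) := by
    refine tendsto_eLpNorm_two_of_dominated ((f.memLp 2).const_mul 2)
      (Eventually.of_forall fun l => ((hM.comp (continuous_add_const (l • e))).mul
        f.continuous).aestronglyMeasurable)
      (Eventually.of_forall fun l => Eventually.of_forall fun ξ => ?_)
      (Eventually.of_forall fun ξ => ?_)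
    · rw [norm_mul, norm_mul]
      gcongr
      refine (norm_sub_le _ _).trans ?_
      rw [hnormexp, hnormexp]
      norm_num
    · have h : Tendsto (fun l : ℝ => M (ξ + l • e)) atTop (𝓝 0) := by
        refine squeeze_zero_norm (fun l => norm_exp_sub_exp_le _ _) ?_
        simpa [← mul_sub] using ((tendsto_symbol_add_smul_sub e he ξ).const_mul t).abs
      simpa using h.mul_const (f ξ)
  simp only [hnorm]
  simpa [Function.comp_def] using (ENNReal.tendsto_toReal ENNReal.zero_ne_top).comp hlim

end

/-! ### Half-spaces moving apart with speed one -/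

theorem indicatorOp_apply {X : Set (EuclideanSpace ℝ (Fin d))} (hX : Convex ℝ X) (ψ : L2 d) :
    indicatorOp X hX ψ =ᵐ[volume] X.indicator ψ := by
  refine (mulOp_apply _ (memLp_indicator_convex hX) ψ).trans (Eventually.of_forall fun x => ?_)
  by_cases h : x ∈ X <;> simp [h]

theorem norm_indicatorOp_apply_le {X : Set (EuclideanSpace ℝ (Fin d))} (hX : Convex ℝ X)
    (ψ : L2 d) : ‖indicatorOp X hX ψ‖ ≤ ‖ψ‖ := by
  refine Lp.norm_le_norm_of_ae_le ?_
  filter_upwards [indicatorOp_apply hX ψ] with x h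
  rw [h]
  exact norm_indicator_le_norm_self _ _

theorem indicatorOp_apply_eq_self {X : Set (EuclideanSpace ℝ (Fin d))} (hX : Convex ℝ X)
    {ψ : L2 d} {f : EuclideanSpace ℝ (Fin d) → ℂ} (hf : ψ =ᵐ[volume] f)
    (hX' : ∀ x ∉ X, f x = 0) : indicatorOp X hX ψ = ψ := by
  refine Lp.ext ?_
  filter_upwards [indicatorOp_apply hX ψ, hf] with x h1 h2
  rw [h1]
  by_cases h : x ∈ X
  · rw [Set.indicator_of_mem h]
  · rw [Set.indicator_of_notMem h, h2, hX' x h]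

theorem convex_coord_le (i : Fin d) (r : ℝ) :
    Convex ℝ {x : EuclideanSpace ℝ (Fin d) | x i ≤ r} :=
  convex_halfSpace_le (EuclideanSpace.proj (𝕜 := ℝ) i).toLinearMap.isLinear r

theorem convex_coord_ge (i : Fin d) (r : ℝ) :
    Convex ℝ {x : EuclideanSpace ℝ (Fin d) | r ≤ x i} :=
  convex_halfSpace_ge (EuclideanSpace.proj (𝕜 := ℝ) i).toLinearMap.isLinear r

theorem le_setDist_halfSpaces (i : Fin d) (r : ℝ) :
    r ≤ setDist {x : EuclideanSpace ℝ (Fin d) | x i ≤ 0} {x | r ≤ x i} := by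
  refine le_csInf ⟨_, 0, by simp, EuclideanSpace.single i r, by simp, rfl⟩ ?_
  rintro _ ⟨x, hx, y, hy, rfl⟩
  have h := PiLp.norm_apply_le (x - y) i
  rw [Real.norm_eq_abs, PiLp.sub_apply] at h
  have hx' : x i ≤ 0 := hx
  have hy' : r ≤ y i := hy
  linarith [neg_abs_le (x i - y i)]

/-- The slab has width one, which is why the target half-space begins at `t - 1` rather than at `t`.
-/
theorem exists_bump_in_slab (i : Fin d) :
    ∃ φ : EuclideanSpace ℝ (Fin d) → ℂ, ContDiff ℝ ∞ φ ∧ HasCompactSupport φ ∧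
      (∀ x, φ x ≠ 0 → -1 < x i ∧ x i < 0) ∧ eLpNorm φ 2 volume ≠ 0 := by
  have hopen : IsOpen {x : EuclideanSpace ℝ (Fin d) | -1 < x i ∧ x i < 0} := by
    have : Continuous fun x : EuclideanSpace ℝ (Fin d) => x i := by fun_prop
    exact (isOpen_lt continuous_const this).inter (isOpen_lt this continuous_const)
  have hmem : EuclideanSpace.single i (-1 / 2 : ℝ) ∈
      {x : EuclideanSpace ℝ (Fin d) | -1 < x i ∧ x i < 0} := by
    simp only [Set.mem_ofPred_eq, PiLp.single_apply, if_true]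
    norm_num
  obtain ⟨f, hsupp, hcomp, hf, -, hone⟩ :=
    exists_contDiff_tsupport_subset (n := ⊤) (hopen.mem_nhds hmem)
  have hφ : ContDiff ℝ ∞ fun x => (f x : ℂ) := Complex.ofRealCLM.contDiff.comp hf
  refine ⟨fun x => (f x : ℂ), hφ, hcomp.comp_left (g := ((↑) : ℝ → ℂ)) Complex.ofReal_zero,
    fun x hx => hsupp (subset_tsupport f (Complex.ofReal_ne_zero.1 hx)), fun h => ?_⟩
  rw [eLpNorm_eq_zero_iff hφ.continuous.aestronglyMeasurable (by norm_num)] at h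
  have h0 := congrFun ((Continuous.ae_eq_iff_eq volume hφ.continuous continuous_const).1 h)
    (EuclideanSpace.single i (-1 / 2 : ℝ))
  exact one_ne_zero (Complex.ofReal_eq_zero.1 (hone ▸ h0))

/-- The free evolution transports a state of norm one between half-spaces of distance `t - 1` in
time `t`, up to an arbitrarily small error. -/
theorem one_le_norm_halfSpaces (i : Fin d) (t : ℝ) :
    1 ≤ ‖indicatorOp {x | t - 1 ≤ x i} (convex_coord_ge i (t - 1)) ∘L freeEvolution d t ∘L
      indicatorOp {x | x i ≤ 0} (convex_coord_le i 0)‖ := by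
  set A := indicatorOp {x | t - 1 ≤ x i} (convex_coord_ge i (t - 1)) ∘L freeEvolution d t ∘L
      indicatorOp {x | x i ≤ 0} (convex_coord_le i 0) with hA
  obtain ⟨φ, hφ, hc, hsupp, hne⟩ := exists_bump_in_slab i
  set e : EuclideanSpace ℝ (Fin d) := EuclideanSpace.single i 1 with he
  have hnorm : ‖e‖ = 1 := by simp [he]
  set N := (eLpNorm φ 2 volume).toReal with hN
  have hzero : ∀ (l s : ℝ) (x : EuclideanSpace ℝ (Fin d)),
      wavePacket φ e l s x ≠ 0 → -1 < x i - s ∧ x i - s < 0 := fun l s x hx => by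
    have := hsupp _ (right_ne_zero_of_mul hx)
    simpa [he] using this
  have hX : ∀ l, indicatorOp {x | x i ≤ 0} (convex_coord_le i 0) (wavePacketLp hφ hc e l 0) =
      wavePacketLp hφ hc e l 0 := fun l =>
    indicatorOp_apply_eq_self _ (coeFn_wavePacketLp hφ hc e l 0) fun x hx => by
      by_contra h
      have := hzero l 0 x h
      exact hx (by simp only [Set.mem_ofPred_eq]; linarith)
  have hY : ∀ l, indicatorOp {x | t - 1 ≤ x i} (convex_coord_ge i (t - 1))
      (wavePacketLp hφ hc e l t) = wavePacketLp hφ hc e l t := fun l =>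
    indicatorOp_apply_eq_self _ (coeFn_wavePacketLp hφ hc e l t) fun x hx => by
      by_contra h
      have := hzero l t x h
      exact hx (by simp only [Set.mem_ofPred_eq]; linarith)
  have hNpos : 0 < N := by
    have hmem : MemLp φ 2 volume := hφ.continuous.memLp_of_hasCompactSupport hc
    exact ENNReal.toReal_pos hne hmem.eLpNorm_ne_top
  -- Both cut-offs leave the exact packets unchanged and the outer one is a contraction, so only the
  -- transport error is lost. As `A` does not involve `l`, the limit gives `N ≤ ‖A‖ * N`.
  have hle : ∀ l : ℝ, N - ‖freeEvolution d t (wavePacketLp hφ hc e l 0) -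
      wavePacketLp hφ hc e l t‖ ≤ ‖A‖ * N := fun l => by
    have h1 : ‖A (wavePacketLp hφ hc e l 0)‖ ≤ ‖A‖ * N := by
      simpa only [norm_wavePacketLp] using A.le_opNorm (wavePacketLp hφ hc e l 0)
    have h2 : A (wavePacketLp hφ hc e l 0) - wavePacketLp hφ hc e l t =
        indicatorOp {x | t - 1 ≤ x i} (convex_coord_ge i (t - 1))
          (freeEvolution d t (wavePacketLp hφ hc e l 0) - wavePacketLp hφ hc e l t) := by
      rw [map_sub, hY, hA, ContinuousLinearMap.comp_apply, ContinuousLinearMap.comp_apply, hX]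
    have h3 := norm_indicatorOp_apply_le (convex_coord_ge i (t - 1))
      (freeEvolution d t (wavePacketLp hφ hc e l 0) - wavePacketLp hφ hc e l t)
    rw [← h2] at h3
    have h4 := norm_sub_norm_le (wavePacketLp hφ hc e l t) (A (wavePacketLp hφ hc e l 0))
    rw [norm_sub_rev, norm_wavePacketLp, ← hN] at h4
    linarith
  have hlim := (tendsto_freeEvolution_wavePacket hφ hc e hnorm t).const_sub N
  rw [sub_zero] at hlim
  have := le_of_tendsto hlim (Eventually.of_forall hle)
  exact le_of_mul_le_mul_right (by linarith) hNpos

/-- A propagation speed below one is violated by the free evolution. -/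
theorem exists_exp_lt_norm_freeEvolution (hd : 1 ≤ d) {δ : ℝ} (hδ : δ < 1) :
    ∃ (t : ℝ) (X Y : Set (EuclideanSpace ℝ (Fin d))) (hX : Convex ℝ X) (hY : Convex ℝ Y),
      0 < t ∧ X.Nonempty ∧ Y.Nonempty ∧
      Real.exp (δ * t - setDist X Y) <
        ‖indicatorOp Y hY ∘L freeEvolution d t ∘L indicatorOp X hX‖ := by
  let i : Fin d := ⟨0, hd⟩
  have hδ' : 0 < 1 - δ := sub_pos.2 hδ
  -- Any `t` with `(1 - δ)t > 1` makes `δt - (t - 1)` negative; this choice gives the value `-1`.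
  set t : ℝ := 2 / (1 - δ) with ht
  refine ⟨t, {x | x i ≤ 0}, {x | t - 1 ≤ x i}, convex_coord_le i 0, convex_coord_ge i (t - 1),
    by positivity, ⟨0, by simp⟩, ⟨EuclideanSpace.single i (t - 1), by simp⟩,
    lt_of_lt_of_le (Real.exp_lt_one_iff.2 ?_) (one_le_norm_halfSpaces i t)⟩
  have h1 := le_setDist_halfSpaces i (t - 1)
  have h2 : (1 - δ) * t = 2 := mul_div_cancel₀ _ hδ'.ne'
  linarith

end PseudoRelativistic

end

theorem corollaryA2 (d : ℕ) (hd : 1 ≤ d) :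
    (∀ δ : ℝ, δ < 1 →
      ∃ (t : ℝ) (X Y : Set (EuclideanSpace ℝ (Fin d))) (hX : Convex ℝ X) (hY : Convex ℝ Y),
        0 < t ∧ X.Nonempty ∧ Y.Nonempty ∧
        Real.exp (δ * t - PseudoRelativistic.setDist X Y) <
          ‖PseudoRelativistic.indicatorOp Y hY ∘L PseudoRelativistic.freeEvolution d t ∘L
            PseudoRelativistic.indicatorOp X hX‖) ∧
    (∀ c : ℝ, c < 1 →
      ∃ (T : ℝ) (U : ℝ → ℝ → (PseudoRelativistic.L2 d →L[ℂ] PseudoRelativistic.L2 d))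
        (X Y : Set (EuclideanSpace ℝ (Fin d))) (hX : Convex ℝ X) (hY : Convex ℝ Y),
        0 < T ∧
        PseudoRelativistic.IsUnitaryPropagator T (fun _ => PseudoRelativistic.japaneseOp d) U ∧
        X.Nonempty ∧ Y.Nonempty ∧
        ¬ ∀ t ∈ Set.Icc 0 T,
          ‖PseudoRelativistic.indicatorOp Y hY ∘L U t 0 ∘L PseudoRelativistic.indicatorOp X hX‖ ≤
            Real.exp (c * t - PseudoRelativistic.setDist X Y)) := by
  refine ⟨fun δ hδ => PseudoRelativistic.exists_exp_lt_norm_freeEvolution hd hδ, fun c hc => ?_⟩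
  obtain ⟨t, X, Y, hX, hY, ht, hXne, hYne, hlt⟩ :=
    PseudoRelativistic.exists_exp_lt_norm_freeEvolution hd hc
  refine ⟨t, fun r s => PseudoRelativistic.freeEvolution d (r - s), X, Y, hX, hY, ht,
    PseudoRelativistic.isUnitaryPropagator_freeEvolution d t, hXne, hYne, fun h => ?_⟩
  -- The horizon `T` was chosen to be the violating time, so the estimate fails at the right
  -- endpoint.
  have hle := h t ⟨ht.le, le_rfl⟩
  simp only [sub_zero] at hle
  exact hlt.not_ge hle
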